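/- Let $\mathbb K\in\{\mathbb R,\mathbb C\}$. A topological $\mathbb K$-vector space is *weakly complete* if it is isomorphic, as a topological vector space, to $\mathbb K^J$ for some set $J$. A *weakly complete unital algebra* is a unital associative $\mathbb K$-algebra on a weakly complete vector space with (jointly) continuous multiplication; morphisms are the continuous unital algebra homomorphisms. For such an algebra $A$ write $A_{\rm Lie}$ for the topological Lie algebra $A$ with bracket $[a,b]=ab-ba$. For a topological Lie algebra $\mathfrak g$ over $\mathbb K$, its *weakly complete enveloping algebra* is the (up to unique isomorphism unique) weakly complete unital algebra $\mathbf U(\mathfrak g)$ together with a continuous Lie algebra morphism $\lambda_{\mathfrak g}\colon\mathfrak g\to\mathbf U(\mathfrak g)_{\rm Lie}$ such that for every weakly complete unital algebra $A$ and every continuous Lie algebra morphism $f\colon\mathfrak g\to A_{\rm Lie}$ there is a unique morphism $f'\colon\mathbf U(\mathfrak g)\to A$ of weakly complete unital algebras with $f=f'\circ\lambda_{\mathfrak g}$. For a continuous Lie algebra morphism $h\colon\mathfrak g\to\mathfrak h$, $\mathbf U(h)\colon\mathbf U(\mathfrak g)\to\mathbf U(\mathfrak h)$ is the unique morphism with $\mathbf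 U(h)\circ\lambda_{\mathfrak g}=\lambda_{\mathfrak h}\circ h$. Let $\mathcal I(\mathfrak g)$ be the set of closed ideals $I$ of $\mathfrak g$ with $\dim\mathfrak g/I<\infty$, let $p_I\colon\mathfrak g\to\mathfrak g/I$ be the quotient morphisms ($\mathfrak g/I$ with the quotient topology), and let $p_{IJ}\colon\mathfrak g/J\to\mathfrak g/I$ be the natural morphisms for $J\subseteq I$. The topological Lie algebra $\mathfrak g$ is *profinite-dimensional* if the natural morphism $\mathfrak g\to\lim_{I\in\mathcal I(\mathfrak g)}\mathfrak g/I$ is an isomorphism of topological Lie algebras. **Theorem.** Let $\mathfrak g$ be a profinite-dimensional Lie algebra over $\mathbb K$. Let $\lim_{I\in\mathcal I(\mathfrak g)}\mathbf U(\mathfrak g/I)$ be the projective limit, in the category of weakly complete unital algebras, of the system formed by the algebras $\mathbf U(\mathfrak g/I)$ and the morphisms $\mathbf U(p_{IJ})$ for $J\subseteq I$, with limit maps $\pi_I$. Then the natural morphism $\omega_{\mathfrak g}\colon\mathbf U(\mathfrak g)\to\lim_{I\in\mathcal I(\mathfrak g)}\mathbf U(\mathfrak g/I)$, given by $\pi_I\circ\omega_{\mathfrak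 g}=\mathbf U(p_I)$ for all $I\in\mathcal I(\mathfrak g)$, is an isomorphism of weakly complete unital algebras (algebraic and topological). In short, $$\mathfrak g\cong\lim_{I\in\mathcal I(\mathfrak g)}\mathfrak g/I\quad\text{(as profinite-dimensional Lie algebras)}\qquad\text{and}\qquad \mathbf U(\mathfrak g)\cong\lim_{I\in\mathcal I(\mathfrak g)}\mathbf U(\mathfrak g/I)\quad\text{(as weakly complete unital algebras)}.$$ -/

import Mathlib

open Topology
universe u

/-- A topological vector space over `𝕜` is weakly complete if it is isomorphic, as a topological
vector space, to a power `𝕜 ^ J` with the product topology. -/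
def IsWeaklyComplete (𝕜 : Type) [RCLike 𝕜] (E : Type u) [AddCommGroup E] [Module 𝕜 E]
    [TopologicalSpace E] : Prop :=
  ∃ J : Type u, Nonempty (E ≃L[𝕜] (J → 𝕜))

/-- A weakly complete unital associative `𝕜`-algebra: a weakly complete vector space with a
(jointly) continuous associative multiplication and a unit. The continuous algebra homomorphisms
`A →A[𝕜] B` are the morphisms of weakly complete unital algebras. -/
structure WCAlg (𝕜 : Type) [RCLike 𝕜] : Type (u + 1) where
  carrier : Type u
  [ring : Ring carrier]
  [algebra : Algebra 𝕜 carrier]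
  [top : TopologicalSpace carrier]
  [topRing : IsTopologicalRing carrier]
  weaklyComplete : IsWeaklyComplete 𝕜 carrier

namespace WCAlg

variable {𝕜 : Type} [RCLike 𝕜]

instance : CoeSort (WCAlg.{u} 𝕜) (Type u) := ⟨WCAlg.carrier⟩

instance (A : WCAlg.{u} 𝕜) : Ring A := A.ring
instance (A : WCAlg.{u} 𝕜) : Algebra 𝕜 A := A.algebra
instance (A : WCAlg.{u} 𝕜) : TopologicalSpace A := A.top
instance (A : WCAlg.{u} 𝕜) : IsTopologicalRing A := A.topRing

/-- The underlying Lie algebra of `A`, with bracket `⁅a, b⁆ = a * b - b * a`. -/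
instance (A : WCAlg.{u} 𝕜) : LieRing A := LieRing.ofAssociativeRing
instance (A : WCAlg.{u} 𝕜) : LieAlgebra 𝕜 A := LieAlgebra.ofAssociativeAlgebra

theorem lie_def (A : WCAlg.{u} 𝕜) (a b : A) : ⁅a, b⁆ = a * b - b * a := rfl

instance (A : WCAlg.{u} 𝕜) : T2Space A := by
  obtain ⟨J, ⟨e⟩⟩ := A.weaklyComplete
  exact e.toHomeomorph.symm.t2Space

instance (A : WCAlg.{u} 𝕜) : ContinuousSMul 𝕜 A := by
  obtain ⟨J, ⟨e⟩⟩ := A.weaklyComplete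
  exact e.toHomeomorph.isInducing.continuousSMul continuous_id (by intro c x; exact e.map_smul c x)

end WCAlg

/-! ### Weakly complete vector spaces: products and closed subspaces -/

section WeaklyComplete

variable {𝕜 : Type} [RCLike 𝕜]

theorem isWeaklyComplete_of_isClosedEmbedding {E : Type u} [AddCommGroup E] [Module 𝕜 E]
    [TopologicalSpace E] {J : Type*} (f : E →ₗ[𝕜] (J → 𝕜)) (hf : IsClosedEmbedding f) :
    IsWeaklyComplete 𝕜 E := by
  classical
  let c : J → Module.Dual 𝕜 E := fun j => (LinearMap.proj j).comp f
  obtain ⟨b, hbt, hspan, hli⟩ := exists_linearIndependent 𝕜 (Set.range c)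
  have hc : ∀ j, c j ∈ Submodule.span 𝕜 b := fun j => by
    rw [hspan]; exact Submodule.subset_span ⟨j, rfl⟩
  let Bs := Module.Basis.span hli
  have hr : Submodule.span 𝕜 (Set.range ((↑) : b → Module.Dual 𝕜 E)) = Submodule.span 𝕜 b := by
    rw [Subtype.range_coe]
  let Φ : E →ₗ[𝕜] (b → 𝕜) := LinearMap.pi fun β => β.1
  have hinj : Function.Injective Φ := by
    rw [injective_iff_map_eq_zero]
    intro w hw
    have h0 : ∀ d ∈ Submodule.span 𝕜 b, d w = 0 := by
      intro d hd
      induction hd using Submodule.span_induction with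
      | mem x hx => exact congrFun hw ⟨x, hx⟩
      | zero => rfl
      | add x y _ _ hx hy => simp [hx, hy]
      | smul a x _ hx => simp [hx]
    exact hf.injective (by ext j; simpa [c] using h0 _ (hc j))
  have hsurj : Function.Surjective Φ := by
    intro t
    let τ := Bs.constr 𝕜 t
    have hc' : ∀ j, c j ∈ Submodule.span 𝕜 (Set.range ((↑) : b → Module.Dual 𝕜 E)) :=
      fun j => hr ▸ hc j
    let q : J → 𝕜 := fun j => τ ⟨c j, hc' j⟩
    have hq : q ∈ Set.range f := by
      rw [← hf.isClosed_range.closure_eq, mem_closure_iff]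
      intro o ho hqo
      obtain ⟨S, v, hv, hSo⟩ := isOpen_pi_iff.1 ho q hqo
      let g : E →ₗ[𝕜] (S → 𝕜) := LinearMap.pi fun s => c s.1
      have hg : (fun s : S => q s.1) ∈ LinearMap.range g := by
        by_contra hn
        obtain ⟨φ, hφ, hle⟩ := Submodule.exists_le_ker_of_notMem hn
        apply hφ
        set a : S → 𝕜 := fun i => φ fun j => if i = j then 1 else 0 with ha
        have h1 : ∑ s : S, a s • c s.1 = 0 := by
          ext w
          have : φ (g w) = 0 := hle ⟨w, rfl⟩
          rw [LinearMap.pi_apply_eq_sum_univ] at this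
          simp only [LinearMap.sum_apply, LinearMap.smul_apply, LinearMap.zero_apply]
          rw [← this]
          refine Finset.sum_congr rfl fun s _ => ?_
          simp [a, g, mul_comm]
        have h2 : ∑ s : S, a s • (⟨c s.1, hc' s.1⟩ :
            Submodule.span 𝕜 (Set.range ((↑) : b → Module.Dual 𝕜 E))) = 0 := by
          ext1; simpa using h1
        have h3 := congrArg τ h2
        rw [LinearMap.pi_apply_eq_sum_univ]
        simp only [map_sum, map_smul, map_zero] at h3
        refine Eq.trans (Finset.sum_congr rfl fun s _ => ?_) h3
        rw [smul_eq_mul, smul_eq_mul, mul_comm]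
      obtain ⟨w, hw⟩ := hg
      refine ⟨f w, hSo fun s hs => ?_, w, rfl⟩
      have := congrFun hw ⟨s, hs⟩
      have h' : f w s = q s := this
      rw [h']; exact (hv s hs).2
    obtain ⟨w, hw⟩ := hq
    refine ⟨w, ?_⟩
    ext β
    obtain ⟨j, hj⟩ := hbt β.2
    have h1 : Φ w β = f w j := by
      change β.1 w = _
      rw [← hj]; rfl
    rw [h1, hw]
    change τ ⟨c j, _⟩ = _
    have : (⟨c j, hc' j⟩ : Submodule.span 𝕜 (Set.range ((↑) : b → Module.Dual 𝕜 E))) = Bs β := by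
      ext1; simp [Bs, Module.Basis.span_apply, hj]
    rw [this]; simp [τ, Module.Basis.constr_basis]
  let e := LinearEquiv.ofBijective Φ ⟨hinj, hsurj⟩
  have hcont : Continuous Φ := by
    refine continuous_pi fun β => ?_
    obtain ⟨j, hj⟩ := hbt β.2
    have : (fun w => Φ w β) = fun w => f w j := by
      ext w
      change β.1 w = _
      rw [← hj]; rfl
    rw [this]
    exact (continuous_apply j).comp hf.continuous
  have hes : ∀ t, Φ (e.symm t) = t := fun t => e.apply_symm_apply t
  have hinv : Continuous e.symm := by
    rw [hf.isInducing.continuous_iff]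
    refine continuous_pi fun j => ?_
    have h0 : ∀ d ∈ Submodule.span 𝕜 b, Continuous fun t => d (e.symm t) := by
      intro d hd
      induction hd using Submodule.span_induction with
      | mem x hx =>
        have : (fun t => x (e.symm t)) = fun t => t ⟨x, hx⟩ := by
          ext t; exact congrFun (hes t) ⟨x, hx⟩
        rw [this]; exact continuous_apply _
      | zero => exact continuous_const
      | add x y _ _ hx hy => exact hx.add hy
      | smul a x _ hx => exact hx.const_smul a
    exact h0 _ (hc j)
  exact ⟨b, ⟨{ e with continuous_toFun := hcont, continuous_invFun := hinv }⟩⟩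

theorem exists_pi_equiv {ι : Type*} {E J : ι → Type*} [∀ i, AddCommGroup (E i)]
    [∀ i, Module 𝕜 (E i)] [∀ i, TopologicalSpace (E i)] (e : ∀ i, E i ≃L[𝕜] (J i → 𝕜)) :
    Nonempty ((∀ i, E i) ≃L[𝕜] ((Σ i, J i) → 𝕜)) :=
  ⟨{ toFun := fun x p => e p.1 (x p.1) p.2
     invFun := fun y i => (e i).symm fun j => y ⟨i, j⟩
     map_add' := fun x y => by ext p; simp
     map_smul' := fun a x => by ext p; simp
     left_inv := fun x => funext fun i => (e i).symm_apply_apply (x i)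
     right_inv := fun y => by ext p; simp
     continuous_toFun := by
      refine continuous_pi fun p => ?_
      exact (continuous_apply _).comp ((e p.1).continuous.comp (continuous_apply _))
     continuous_invFun := by
      refine continuous_pi fun i => (e i).symm.continuous.comp ?_
      exact continuous_pi fun j => continuous_apply _ }⟩

theorem Subalgebra.isTopologicalRing_coe {R : Type*} [Ring R] [Algebra 𝕜 R] [TopologicalSpace R]
    [IsTopologicalRing R] (S : Subalgebra 𝕜 R) : IsTopologicalRing S :=
  inferInstanceAs (IsTopologicalRing S.toSubring)

/-- A closed subalgebra of a product of algebras which are powers of `𝕜` as topological vector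
spaces is weakly complete. -/
theorem isWeaklyComplete_of_isClosed {ι : Type*} {E : ι → Type*} {J : ι → Type*}
    [∀ i, Ring (E i)] [∀ i, Algebra 𝕜 (E i)] [∀ i, TopologicalSpace (E i)]
    (e : ∀ i, E i ≃L[𝕜] (J i → 𝕜)) (S : Subalgebra 𝕜 (∀ i, E i)) (hS : IsClosed (S : Set (∀ i, E i))) :
    IsWeaklyComplete 𝕜 S := by
  obtain ⟨P⟩ := exists_pi_equiv e
  exact isWeaklyComplete_of_isClosedEmbedding (P.toLinearEquiv.toLinearMap.comp S.val.toLinearMap)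
    (P.toHomeomorph.isClosedEmbedding.comp hS.isClosedEmbedding_subtypeVal)

end WeaklyComplete

/-! ### The weakly complete enveloping algebra -/

section Enveloping

variable {𝕜 : Type} [RCLike 𝕜]

/-- Every continuous functional on a weakly complete algebra is a coefficient of a continuous
finite-dimensional matrix representation. -/
theorem WCAlg.exists_rep (A : WCAlg.{u} 𝕜) (φ : A →L[𝕜] 𝕜) :
    ∃ (n : ℕ) (ρ : A →ₐ[𝕜] Matrix (Fin n) (Fin n) 𝕜) (ψ : Matrix (Fin n) (Fin n) 𝕜 →ₗ[𝕜] 𝕜),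
      Continuous ρ ∧ ∀ a, φ a = ψ (ρ a) := by
  classical
  obtain ⟨J, ⟨e⟩⟩ := A.weaklyComplete
  -- the largest left ideal contained in the kernel of `φ`
  let M : Submodule 𝕜 A :=
    { carrier := {a | ∀ y, φ (y * a) = 0}
      zero_mem' := fun y => by simp
      add_mem' := fun {a b} ha hb y => by simp [mul_add, ha y, hb y]
      smul_mem' := fun c a ha y => by simp [ha y] }
  have hMmul : ∀ (x a : A), a ∈ M → x * a ∈ M := fun x a ha y => by
    rw [← mul_assoc]; exact ha _
  have hMclosed : IsClosed (M : Set A) := by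
    have : (M : Set A) = ⋂ y, {a | φ (y * a) = 0} := by ext; simp [M]
    rw [this]
    exact isClosed_iInter fun y => isClosed_eq (φ.continuous.comp (continuous_const.mul continuous_id))
      continuous_const
  -- by continuity of the multiplication, finitely many coordinates control `φ (x * y)`
  obtain ⟨S, hS⟩ : ∃ S : Finset J, ∀ x y : A, (∀ s ∈ S, e x s = 0) → (∀ s ∈ S, e y s = 0) →
      φ (x * y) = 0 := by
    have hcont : Continuous fun p : (J → 𝕜) × (J → 𝕜) => φ (e.symm p.1 * e.symm p.2) := by
      fun_prop
    have hnear : {p : (J → 𝕜) × (J → 𝕜) | ‖φ (e.symm p.1 * e.symm p.2)‖ < 1} ∈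
        nhds ((0 : J → 𝕜), (0 : J → 𝕜)) := by
      apply (isOpen_lt hcont.norm continuous_const).mem_nhds
      simp
    rw [nhds_prod_eq, Filter.mem_prod_iff] at hnear
    obtain ⟨t₁, h₁, t₂, h₂, h₁₂⟩ := hnear
    obtain ⟨o₁, ho₁, hoo₁, hz₁⟩ := mem_nhds_iff.1 h₁
    obtain ⟨o₂, ho₂, hoo₂, hz₂⟩ := mem_nhds_iff.1 h₂
    obtain ⟨S₁, v₁, hv₁, hs₁⟩ := isOpen_pi_iff.1 hoo₁ 0 hz₁
    obtain ⟨S₂, v₂, hv₂, hs₂⟩ := isOpen_pi_iff.1 hoo₂ 0 hz₂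
    refine ⟨S₁ ∪ S₂, fun x y hx hy => ?_⟩
    by_contra hne
    have key : ∀ c : 𝕜, ‖c * φ (x * y)‖ < 1 := by
      intro c
      have hcx : e (c • x) ∈ t₁ := ho₁ (hs₁ fun s hs => by
        have : e (c • x) s = 0 := by simp [hx s (Finset.mem_union_left _ hs)]
        rw [this]; exact (hv₁ s hs).2)
      have hcy : e y ∈ t₂ := ho₂ (hs₂ fun s hs => by
        have : e y s = 0 := hy s (Finset.mem_union_right _ hs)
        rw [this]; exact (hv₂ s hs).2)
      have := h₁₂ (Set.mk_mem_prod hcx hcy)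
      simpa using this
    have := key (φ (x * y))⁻¹
    rw [inv_mul_cancel₀ hne] at this
    simp at this
  have hfin : FiniteDimensional 𝕜 (A ⧸ M) := by
    let u : J → A := fun s => e.symm (Pi.single s 1)
    let G : A →ₗ[𝕜] (S → 𝕜) × (S → 𝕜) := LinearMap.prod
      (LinearMap.pi fun s => (LinearMap.proj s.1).comp e.toLinearEquiv.toLinearMap)
      (LinearMap.pi fun s => φ.toLinearMap.comp (LinearMap.mulLeft 𝕜 (u s.1)))
    have hG : LinearMap.ker G ≤ M := by
      intro x hx y
      have hx1 : ∀ s ∈ S, e x s = 0 := fun s hs => congrFun (congrArg Prod.fst hx) ⟨s, hs⟩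
      have hx2 : ∀ s ∈ S, φ (u s * x) = 0 := fun s hs => congrFun (congrArg Prod.snd hx) ⟨s, hs⟩
      set z := ∑ s ∈ S, e y s • u s with hz
      have h1 : φ (z * x) = 0 := by
        rw [hz, Finset.sum_mul, map_sum]
        exact Finset.sum_eq_zero fun s hs => by simp [hx2 s hs]
      have h2 : φ ((y - z) * x) = 0 := by
        refine hS _ _ (fun s hs => ?_) hx1
        rw [map_sub, hz, map_sum]
        simp [u, Finset.sum_apply, Pi.single_apply, hs]
      have : y * x = z * x + (y - z) * x := by noncomm_ring
      rw [this, map_add, h1, h2, add_zero]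
    have : FiniteDimensional 𝕜 (A ⧸ LinearMap.ker G) :=
      Module.Finite.equiv G.quotKerEquivRange.symm
    exact Module.Finite.of_surjective (Submodule.factor hG) (Submodule.factor_surjective hG)
  let B := Module.finBasis 𝕜 (A ⧸ M)
  let lft : A →ₐ[𝕜] Module.End 𝕜 (A ⧸ M) := AlgHom.ofLinearMap
    { toFun := fun a => M.mapQ M (LinearMap.mulLeft 𝕜 a) (fun x hx => hMmul a x hx)
      map_add' := fun a b => by
        refine Submodule.linearMap_qext _ (LinearMap.ext fun x => ?_)
        change M.mkQ ((a + b) * x) = M.mkQ (a * x) + M.mkQ (b * x)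
        rw [add_mul, map_add]
      map_smul' := fun c a => by
        refine Submodule.linearMap_qext _ (LinearMap.ext fun x => ?_)
        change M.mkQ ((c • a) * x) = c • M.mkQ (a * x)
        rw [smul_mul_assoc, map_smul] }
    (by refine Submodule.linearMap_qext _ (LinearMap.ext fun x => ?_); simp)
    (fun a b => by
      refine Submodule.linearMap_qext _ (LinearMap.ext fun x => ?_)
      change M.mkQ ((a * b) * x) = M.mkQ (a * (b * x))
      rw [mul_assoc])
  have hlft : ∀ a x, lft a (M.mkQ x) = M.mkQ (a * x) := fun a x => rfl
  let ev : A ⧸ M →ₗ[𝕜] 𝕜 := M.liftQ φ.toLinearMap (fun a ha => by simpa using ha 1)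
  refine ⟨_, (LinearMap.toMatrixAlgEquiv B).toAlgHom.comp lft,
    (ev.comp (LinearMap.applyₗ (M.mkQ 1))).comp
      (LinearMap.toMatrixAlgEquiv B).symm.toLinearEquiv.toLinearMap, ?_, fun a => ?_⟩
  · refine continuous_pi fun i => continuous_pi fun j => ?_
    obtain ⟨x, hx⟩ := M.mkQ_surjective (B j)
    have : (fun a => ((LinearMap.toMatrixAlgEquiv B).toAlgHom.comp lft) a i j) =
        ((B.coord i).comp M.mkQ) ∘ fun a => a * x := by
      ext a
      simp only [AlgHom.comp_apply, Function.comp, LinearMap.comp_apply]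
      change LinearMap.toMatrixAlgEquiv B (lft a) i j = _
      rw [LinearMap.toMatrixAlgEquiv_apply, ← hx, hlft]
      rfl
    rw [this]
    have : IsClosed (M : Set A) := hMclosed
    have hc : Continuous ((B.coord i).comp M.mkQ) :=
      (LinearMap.continuous_of_finiteDimensional (B.coord i)).comp M.continuous_mkQ
    exact hc.comp (continuous_id.mul continuous_const)
  · have : (LinearMap.toMatrixAlgEquiv B).symm
        (((LinearMap.toMatrixAlgEquiv B).toAlgHom.comp lft) a) = lft a :=
      (LinearMap.toMatrixAlgEquiv B).symm_apply_apply _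
    change φ a = ev (((LinearMap.toMatrixAlgEquiv B).symm
        (((LinearMap.toMatrixAlgEquiv B).toAlgHom.comp lft) a)) (M.mkQ 1))
    rw [this, hlft, mul_one]
    rfl

variable {𝔤 : Type u} [LieRing 𝔤] [LieAlgebra 𝕜 𝔤] [TopologicalSpace 𝔤]

/-- The universal property of the weakly complete enveloping algebra: `lam : 𝔤 → U` is a continuous
Lie algebra morphism into the underlying Lie algebra of `U`, and every continuous Lie algebra
morphism `f` from `𝔤` into the underlying Lie algebra of a weakly complete unital algebra `A` is
`f' ∘ lam` for a unique morphism `f' : U → A` of weakly complete unital algebras. -/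
def IsEnveloping (U : WCAlg.{u} 𝕜) (lam : 𝔤 →ₗ⁅𝕜⁆ U) : Prop :=
  Continuous lam ∧ ∀ (A : WCAlg.{u} 𝕜) (f : 𝔤 →ₗ⁅𝕜⁆ A), Continuous f →
    ∃! f' : U →A[𝕜] A, ∀ x, f' (lam x) = f x

variable (𝕜 𝔤) in
/-- Every topological Lie algebra has a weakly complete enveloping algebra. -/
theorem exists_isEnveloping :
    ∃ (U : WCAlg.{u} 𝕜) (lam : 𝔤 →ₗ⁅𝕜⁆ U), IsEnveloping U lam := by
  classical
  let ι : Type u := Σ n : ℕ, {f : 𝔤 →ₗ[𝕜] Matrix (Fin n) (Fin n) 𝕜 //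
    Continuous f ∧ ∀ x y, f ⁅x, y⁆ = f x * f y - f y * f x}
  let E : ι → Type := fun i => Matrix (Fin i.1) (Fin i.1) 𝕜
  let lam₀ : 𝔤 →ₗ[𝕜] (∀ i : ι, E i) := LinearMap.pi fun i => i.2.1
  have hlam₀ : Continuous lam₀ := continuous_pi fun i => i.2.2.1
  let S₀ : Subalgebra 𝕜 (∀ i : ι, E i) := Algebra.adjoin 𝕜 (Set.range lam₀)
  let S : Subalgebra 𝕜 (∀ i : ι, E i) := S₀.topologicalClosure
  have hSc : IsClosed (S : Set (∀ i : ι, E i)) := isClosed_closure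
  have hmem : ∀ x, lam₀ x ∈ S := fun x =>
    subset_closure (Algebra.subset_adjoin (Set.mem_range_self x))
  have eE : ∀ i : ι, Nonempty (E i ≃L[𝕜] ((Σ _ : Fin i.1, Fin i.1) → 𝕜)) := fun i =>
    exists_pi_equiv (E := fun _ : Fin i.1 => Fin i.1 → 𝕜) fun _ => ContinuousLinearEquiv.refl 𝕜 _
  have hSr : IsTopologicalRing S := S.isTopologicalRing_coe
  obtain ⟨U, pr, hpr, hpi, hpS⟩ : ∃ (U : WCAlg.{u} 𝕜) (pr : U →ₐ[𝕜] (∀ i : ι, E i)), IsInducing pr ∧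
      Function.Injective pr ∧ ∀ z, z ∈ S ↔ ∃ u, pr u = z :=
    ⟨⟨S, isWeaklyComplete_of_isClosed (fun i => (eE i).some) S hSc⟩, S.val, .subtypeVal,
      Subtype.val_injective, fun z => ⟨fun h => ⟨⟨z, h⟩, rfl⟩, fun ⟨u, hu⟩ => hu ▸ u.2⟩⟩
  choose l hl using fun x => (hpS _).1 (hmem x)
  let lam : 𝔤 →ₗ⁅𝕜⁆ U :=
    { toFun := l
      map_add' := fun x y => hpi (by rw [hl, map_add, map_add, hl, hl])
      map_smul' := fun c x => hpi (by rw [hl, map_smul, map_smul, hl]; rfl)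
      map_lie' := fun {x y} => hpi (by
        rw [hl, WCAlg.lie_def, map_sub, map_mul, map_mul, hl, hl]
        exact funext fun i => i.2.2.2 x y) }
  have hdense : Dense ((Algebra.adjoin 𝕜 (Set.range lam) : Subalgebra 𝕜 U) : Set U) := by
    have himg : (Algebra.adjoin 𝕜 (Set.range lam)).map pr = S₀ := by
      rw [AlgHom.map_adjoin]
      congr 1
      ext z
      constructor
      · rintro ⟨_, ⟨x, rfl⟩, rfl⟩; exact ⟨x, (hl x).symm⟩
      · rintro ⟨x, rfl⟩; exact ⟨_, ⟨x, rfl⟩, hl x⟩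
    rw [dense_iff_closure_eq, Set.eq_univ_iff_forall]
    intro z
    rw [hpr.closure_eq_preimage_closure_image]
    have : (pr '' (Algebra.adjoin 𝕜 (Set.range lam) : Set U)) =
        (S₀ : Set (∀ i : ι, E i)) := by
      rw [← himg]; rfl
    rw [this]
    exact (hpS _).2 ⟨z, rfl⟩
  refine ⟨U, lam, hpr.continuous_iff.2 (by convert hlam₀ using 1; exact funext hl), fun A f hf => ?_⟩
  obtain ⟨J, ⟨e⟩⟩ := A.weaklyComplete
  choose n ρ ψ hρ hψ using fun j : J => A.exists_rep ((ContinuousLinearMap.proj j).comp e.toContinuousLinearMap)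
  let idx : J → ι := fun j => ⟨n j, (ρ j).toLinearMap.comp f.toLinearMap, (hρ j).comp hf, fun x y => by
    change ρ j (f ⁅x, y⁆) = ρ j (f x) * ρ j (f y) - ρ j (f y) * ρ j (f x)
    rw [LieHom.map_lie, WCAlg.lie_def, map_sub, map_mul, map_mul]⟩
  -- the candidate, as a continuous linear map
  let F : U → A := fun u => e.symm fun j => ψ j (pr u (idx j))
  have hψc : ∀ j, Continuous (ψ j) := fun j => by
    have := (ψ j).continuous_of_finiteDimensional
    exact this
  have hF : Continuous F := by
    refine e.symm.continuous.comp (continuous_pi fun j => (hψc j).comp ?_)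
    exact (continuous_apply (idx j)).comp hpr.continuous
  have hinv : ∀ a : A, (e.symm fun j => ψ j (ρ j a)) = a := by
    intro a
    have : (fun j => ψ j (ρ j a)) = e a := by
      ext j; rw [← hψ]; rfl
    rw [this]; simp
  have hFlam : ∀ x, F (lam x) = f x := fun x => by
    rw [← hinv (f x)]
    change e.symm _ = e.symm _
    congr 1
    ext j
    change ψ j (pr (l x) (idx j)) = _
    rw [hl]; rfl
  have hρF : ∀ (u : U) (j : J), ρ j (F u) = pr u (idx j) := by
    intro u j
    have hcl : IsClosed {u : U | ρ j (F u) = pr u (idx j)} :=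
      isClosed_eq ((hρ j).comp hF) ((continuous_apply (idx j)).comp hpr.continuous)
    have hall : ∀ u ∈ Algebra.adjoin 𝕜 (Set.range lam), ∃ a : A, ∀ j, ρ j a = pr u (idx j) := by
      intro u hu
      induction hu using Algebra.adjoin_induction with
      | mem u hu => obtain ⟨x, rfl⟩ := hu; exact ⟨f x, fun j => (congrFun (hl x) (idx j)).symm⟩
      | algebraMap r => exact ⟨algebraMap 𝕜 A r, fun j => by rw [(ρ j).commutes, pr.commutes]; rfl⟩
      | add u v _ _ hu hv =>
        obtain ⟨a, ha⟩ := hu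
        obtain ⟨b, hb⟩ := hv
        exact ⟨a + b, fun j => by rw [map_add, ha, hb, map_add]; rfl⟩
      | mul u v _ _ hu hv =>
        obtain ⟨a, ha⟩ := hu
        obtain ⟨b, hb⟩ := hv
        exact ⟨a * b, fun j => by rw [map_mul, ha, hb, map_mul]; rfl⟩
    have : u ∈ closure ((Algebra.adjoin 𝕜 (Set.range lam) : Subalgebra 𝕜 U) : Set U) := hdense u
    refine closure_minimal (fun u hu => ?_) hcl this
    obtain ⟨a, ha⟩ := hall u hu
    have : F u = a := by
      rw [← hinv a]
      change e.symm _ = e.symm _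
      congr 1
      ext j; rw [ha]
    change ρ j (F u) = _
    rw [this, ha]
  have hsep : ∀ a b : A, (∀ j, ρ j a = ρ j b) → a = b := fun a b h => by
    rw [← hinv a, ← hinv b]; simp only [h]
  let f' : U →A[𝕜] A :=
    { toFun := F
      map_one' := hsep _ _ fun j => by rw [hρF, map_one, map_one]; rfl
      map_mul' := fun u v => hsep _ _ fun j => by rw [hρF, map_mul, map_mul, hρF, hρF]; rfl
      map_zero' := hsep _ _ fun j => by rw [hρF, map_zero, map_zero]; rfl
      map_add' := fun u v => hsep _ _ fun j => by rw [hρF, map_add, map_add, hρF, hρF]; rfl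
      commutes' := fun r => hsep _ _ fun j => by rw [hρF, AlgHom.commutes, AlgHom.commutes]; rfl
      cont := hF }
  refine ⟨f', hFlam, fun g hg => ContinuousAlgHom.ext_on hdense ?_⟩
  rintro _ ⟨x, rfl⟩
  rw [hg x]; exact (hFlam x).symm

end Enveloping

section Functor

variable (𝕜 : Type) [RCLike 𝕜]
variable (𝔤 : Type u) [LieRing 𝔤] [LieAlgebra 𝕜 𝔤] [TopologicalSpace 𝔤]
variable (𝔥 : Type u) [LieRing 𝔥] [LieAlgebra 𝕜 𝔥] [TopologicalSpace 𝔥]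

/-- The weakly complete enveloping algebra `𝐔(𝔤)`. It is determined by its universal property up to
a unique isomorphism. -/
noncomputable def WCEnv : WCAlg.{u} 𝕜 := (exists_isEnveloping 𝕜 𝔤).choose

/-- The natural morphism from `𝔤` into the underlying Lie algebra of `𝐔(𝔤)`. -/
noncomputable def WCEnv.lam : 𝔤 →ₗ⁅𝕜⁆ WCEnv 𝕜 𝔤 := (exists_isEnveloping 𝕜 𝔤).choose_spec.choose

theorem WCEnv.isEnveloping : IsEnveloping (WCEnv 𝕜 𝔤) (WCEnv.lam 𝕜 𝔤) :=
  (exists_isEnveloping 𝕜 𝔤).choose_spec.choose_spec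

variable {𝔤 𝔥}

theorem WCEnv.existsUnique_map (f : 𝔤 →ₗ⁅𝕜⁆ 𝔥) (hf : Continuous f) :
    ∃! F : WCEnv 𝕜 𝔤 →A[𝕜] WCEnv 𝕜 𝔥, ∀ x, F (WCEnv.lam 𝕜 𝔤 x) = WCEnv.lam 𝕜 𝔥 (f x) :=
  (WCEnv.isEnveloping 𝕜 𝔤).2 _ ((WCEnv.lam 𝕜 𝔥).comp f) ((WCEnv.isEnveloping 𝕜 𝔥).1.comp hf)

/-- The functor `𝐔` on morphisms: `𝐔(f)` is the unique morphism of weakly complete unital algebras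
with `𝐔(f) ∘ lam = lam ∘ f`. -/
noncomputable def WCEnv.map (f : 𝔤 →ₗ⁅𝕜⁆ 𝔥) (hf : Continuous f) :
    WCEnv 𝕜 𝔤 →A[𝕜] WCEnv 𝕜 𝔥 := (WCEnv.existsUnique_map 𝕜 f hf).choose

theorem WCEnv.map_lam (f : 𝔤 →ₗ⁅𝕜⁆ 𝔥) (hf : Continuous f) (x : 𝔤) :
    WCEnv.map 𝕜 f hf (WCEnv.lam 𝕜 𝔤 x) = WCEnv.lam 𝕜 𝔥 (f x) :=
  (WCEnv.existsUnique_map 𝕜 f hf).choose_spec.1 x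

theorem WCEnv.map_unique (f : 𝔤 →ₗ⁅𝕜⁆ 𝔥) (hf : Continuous f) (F : WCEnv 𝕜 𝔤 →A[𝕜] WCEnv 𝕜 𝔥)
    (hF : ∀ x, F (WCEnv.lam 𝕜 𝔤 x) = WCEnv.lam 𝕜 𝔥 (f x)) : F = WCEnv.map 𝕜 f hf :=
  (WCEnv.existsUnique_map 𝕜 f hf).choose_spec.2 F hF

end Functor

/-! ### Profinite-dimensional Lie algebras -/

section Profinite

variable (𝕜 : Type) [RCLike 𝕜] (𝔤 : Type u) [LieRing 𝔤] [LieAlgebra 𝕜 𝔤] [TopologicalSpace 𝔤]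

/-- A topological Lie algebra over `𝕜`. -/
structure IsTopologicalLieAlgebra : Prop extends IsTopologicalAddGroup 𝔤, ContinuousSMul 𝕜 𝔤 where
  continuous_lie : Continuous fun p : 𝔤 × 𝔤 => ⁅p.1, p.2⁆

/-- The quotient topology on `𝔤 ⧸ I`. -/
instance LieIdeal.quotientTopology {𝕜 : Type} [RCLike 𝕜] {𝔤 : Type u} [LieRing 𝔤]
    [LieAlgebra 𝕜 𝔤] [TopologicalSpace 𝔤] (I : LieIdeal 𝕜 𝔤) : TopologicalSpace (𝔤 ⧸ I) :=
  inferInstanceAs (TopologicalSpace (𝔤 ⧸ (I : Submodule 𝕜 𝔤)))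

variable {𝕜 𝔤}

/-- The quotient morphism `𝔤 → 𝔤 ⧸ I`. -/
def LieIdeal.quot (I : LieIdeal 𝕜 𝔤) : 𝔤 →ₗ⁅𝕜⁆ 𝔤 ⧸ I where
  toFun x := LieSubmodule.Quotient.mk x
  map_add' _ _ := rfl
  map_smul' _ _ := rfl
  map_lie' := rfl

theorem LieIdeal.continuous_quot (I : LieIdeal 𝕜 𝔤) : Continuous I.quot := continuous_quot_mk

/-- For `J ≤ I` the natural morphism `𝔤 ⧸ J → 𝔤 ⧸ I`. -/
def LieIdeal.quotMap {J I : LieIdeal 𝕜 𝔤} (h : J ≤ I) : 𝔤 ⧸ J →ₗ⁅𝕜⁆ 𝔤 ⧸ I where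
  toFun := Submodule.factor (p := (J : Submodule 𝕜 𝔤)) (p' := (I : Submodule 𝕜 𝔤)) h
  map_add' x y := map_add _ x y
  map_smul' c x := map_smul _ c x
  map_lie' {x y} := by
    induction x using Submodule.Quotient.induction_on
    induction y using Submodule.Quotient.induction_on
    rfl

theorem LieIdeal.continuous_quotMap {J I : LieIdeal 𝕜 𝔤} (h : J ≤ I) :
    Continuous (LieIdeal.quotMap h) :=
  Continuous.quotient_lift I.continuous_quot _

variable (𝕜 𝔤)

/-- The closed ideals `I` of `𝔤` with `dim 𝔤 ⧸ I < ∞`, ordered by inclusion. -/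
abbrev CofinIdeal : Type u :=
  {I : LieIdeal 𝕜 𝔤 // IsClosed (I : Set 𝔤) ∧ FiniteDimensional 𝕜 (𝔤 ⧸ I)}

/-- The projective limit of the quotients `𝔤 ⧸ I`, `I` ranging over the closed ideals of finite
codimension, as a subspace of the product with the product topology. -/
def lieLimit : Submodule 𝕜 (∀ I : CofinIdeal 𝕜 𝔤, 𝔤 ⧸ I.1) where
  carrier := {x | ∀ (J I : CofinIdeal 𝕜 𝔤) (h : J.1 ≤ I.1), LieIdeal.quotMap h (x J) = x I}
  zero_mem' _ _ _ := map_zero _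
  add_mem' hx hy J I h := by
    rw [Pi.add_apply, Pi.add_apply, map_add, hx J I h, hy J I h]
  smul_mem' c x hx J I h := by
    rw [Pi.smul_apply, Pi.smul_apply, map_smul, hx J I h]

/-- The componentwise bracket on the projective limit. -/
instance : LieRing (lieLimit 𝕜 𝔤) where
  bracket x y := ⟨fun I => ⁅x.1 I, y.1 I⁆, fun J I h => by
    rw [LieHom.map_lie, x.2 J I h, y.2 J I h]⟩
  add_lie x y z := Subtype.ext (funext fun I => add_lie (x.1 I) (y.1 I) (z.1 I))
  lie_add x y z := Subtype.ext (funext fun I => lie_add (x.1 I) (y.1 I) (z.1 I))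
  lie_self x := Subtype.ext (funext fun I => lie_self (x.1 I))
  leibniz_lie x y z := Subtype.ext (funext fun I => leibniz_lie (x.1 I) (y.1 I) (z.1 I))

instance : LieAlgebra 𝕜 (lieLimit 𝕜 𝔤) where
  lie_smul c x y := Subtype.ext (funext fun I => lie_smul c (x.1 I) (y.1 I))

/-- The natural morphism from `𝔤` to the projective limit of its quotients `𝔤 ⧸ I`. -/
def toLieLimit : 𝔤 →ₗ⁅𝕜⁆ lieLimit 𝕜 𝔤 where
  toFun x := ⟨fun I => I.1.quot x, fun _ _ _ => rfl⟩
  map_add' _ _ := rfl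
  map_smul' _ _ := rfl
  map_lie' := rfl

/-- A topological Lie algebra is profinite-dimensional if it is the projective limit of its
quotients by the closed ideals of finite codimension: the natural (continuous) morphism into this
limit is an isomorphism of topological Lie algebras. -/
structure IsProfiniteDimensional : Prop extends IsTopologicalLieAlgebra 𝕜 𝔤 where
  isHomeomorph_toLieLimit : IsHomeomorph (toLieLimit 𝕜 𝔤)

/-! ### The projective limit of the enveloping algebras of the quotients -/

/-- The elements of the product of the `𝐔(𝔤 ⧸ I)` which are compatible with the morphisms
`𝐔(𝔤 ⧸ J) → 𝐔(𝔤 ⧸ I)` for `J ≤ I`. -/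
noncomputable def envLimitSubalgebra :
    Subalgebra 𝕜 (∀ I : CofinIdeal 𝕜 𝔤, WCEnv 𝕜 (𝔤 ⧸ I.1)) where
  carrier := {x | ∀ (J I : CofinIdeal 𝕜 𝔤) (h : J.1 ≤ I.1),
    WCEnv.map 𝕜 (LieIdeal.quotMap h) (LieIdeal.continuous_quotMap h) (x J) = x I}
  mul_mem' hx hy J I h := by
    rw [Pi.mul_apply, Pi.mul_apply, map_mul, hx J I h, hy J I h]
  add_mem' hx hy J I h := by
    rw [Pi.add_apply, Pi.add_apply, map_add, hx J I h, hy J I h]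
  algebraMap_mem' c J I h := AlgHomClass.commutes _ c

theorem isClosed_envLimitSubalgebra :
    IsClosed (envLimitSubalgebra 𝕜 𝔤 : Set (∀ I : CofinIdeal 𝕜 𝔤, WCEnv 𝕜 (𝔤 ⧸ I.1))) := by
  have : (envLimitSubalgebra 𝕜 𝔤 : Set (∀ I : CofinIdeal 𝕜 𝔤, WCEnv 𝕜 (𝔤 ⧸ I.1))) =
      ⋂ (J : CofinIdeal 𝕜 𝔤) (I : CofinIdeal 𝕜 𝔤) (h : J.1 ≤ I.1),
        {x | WCEnv.map 𝕜 (LieIdeal.quotMap h) (LieIdeal.continuous_quotMap h) (x J) = x I} := by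
    ext x
    simp only [Set.mem_iInter]
    rfl
  rw [this]
  refine isClosed_iInter fun J => isClosed_iInter fun I => isClosed_iInter fun h => ?_
  exact isClosed_eq ((WCEnv.map 𝕜 _ _).continuous.comp (continuous_apply J)) (continuous_apply I)

/-- The projective limit of the weakly complete algebras `𝐔(𝔤 ⧸ I)`, `I` ranging over the closed
ideals of finite codimension: the closed subalgebra of the compatible elements of the product, with
the topology induced by the product topology. -/
noncomputable def envLimit : WCAlg.{u} 𝕜 :=
  letI := (envLimitSubalgebra 𝕜 𝔤).isTopologicalRing_coe
  { carrier := envLimitSubalgebra 𝕜 𝔤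
    weaklyComplete := isWeaklyComplete_of_isClosed
      (fun I => (WCEnv 𝕜 (𝔤 ⧸ I.1)).weaklyComplete.choose_spec.some) _
      (isClosed_envLimitSubalgebra 𝕜 𝔤) }

/-- The limit maps. -/
noncomputable def envLimit.proj (I : CofinIdeal 𝕜 𝔤) : envLimit 𝕜 𝔤 →A[𝕜] WCEnv 𝕜 (𝔤 ⧸ I.1) :=
  (show envLimitSubalgebra 𝕜 𝔤 →A[𝕜] WCEnv 𝕜 (𝔤 ⧸ I.1) from
    { (Pi.evalAlgHom 𝕜 _ I).comp (envLimitSubalgebra 𝕜 𝔤).val with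
      cont := (continuous_apply I).comp continuous_subtype_val })

theorem WCEnv.map_quot_mem (u : WCEnv 𝕜 𝔤) :
    (fun I : CofinIdeal 𝕜 𝔤 => WCEnv.map 𝕜 I.1.quot I.1.continuous_quot u) ∈
      envLimitSubalgebra 𝕜 𝔤 := by
  intro J I h
  have := WCEnv.map_unique 𝕜 I.1.quot I.1.continuous_quot
    ((WCEnv.map 𝕜 (LieIdeal.quotMap h) (LieIdeal.continuous_quotMap h)).comp
      (WCEnv.map 𝕜 J.1.quot J.1.continuous_quot)) (fun x => by
      rw [ContinuousAlgHom.comp_apply, WCEnv.map_lam, WCEnv.map_lam]; rfl)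
  exact DFunLike.congr_fun this u

/-- The natural morphism `ω` from `𝐔(𝔤)` to the projective limit of the `𝐔(𝔤 ⧸ I)`; its components
are the morphisms `𝐔(𝔤) → 𝐔(𝔤 ⧸ I)` induced by the quotient morphisms. -/
noncomputable def toEnvLimit : WCEnv 𝕜 𝔤 →A[𝕜] envLimit 𝕜 𝔤 :=
  (show WCEnv 𝕜 𝔤 →A[𝕜] envLimitSubalgebra 𝕜 𝔤 from
    { toFun := fun u => ⟨fun I => WCEnv.map 𝕜 I.1.quot I.1.continuous_quot u,
        WCEnv.map_quot_mem 𝕜 𝔤 u⟩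
      map_one' := Subtype.ext (funext fun _ => map_one _)
      map_mul' := fun u v => Subtype.ext (funext fun _ => map_mul _ u v)
      map_zero' := Subtype.ext (funext fun _ => map_zero _)
      map_add' := fun u v => Subtype.ext (funext fun _ => map_add _ u v)
      commutes' := fun c => Subtype.ext (funext fun _ => AlgHomClass.commutes _ c)
      cont := (continuous_pi fun _ => (WCEnv.map 𝕜 _ _).continuous).subtype_mk _ })

theorem envLimit.proj_toEnvLimit (I : CofinIdeal 𝕜 𝔤) (u : WCEnv 𝕜 𝔤) :
    envLimit.proj 𝕜 𝔤 I (toEnvLimit 𝕜 𝔤 u) = WCEnv.map 𝕜 I.1.quot I.1.continuous_quot u := rfl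

end Profinite

/-!
The first isomorphism is the definition of profinite-dimensionality. For the second, the morphism
`ω = toEnvLimit 𝕜 𝔤` is inverted by using that both sides are controlled by finite-dimensional
representations.

A continuous functional on `𝐔(𝔤)` is a coefficient of a finite-dimensional representation
(`WCAlg.exists_rep`), that is, of a continuous Lie algebra morphism from `𝔤` to a matrix algebra.
The kernel `I` of the latter is a closed ideal of finite codimension, so by the universal properties
of `𝐔(𝔤)` and `𝐔(𝔤 ⧸ I)` the functional factors through `𝐔(𝔤) → 𝐔(𝔤 ⧸ I)`
(`WCEnv.exists_factor_functional`). Doing this for every coordinate of `𝐔(𝔤) ≃ 𝕜 ^ J` gives a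
continuous left inverse of `ω` (`exists_leftInverse_toEnvLimit`).

On the other hand `ω` has dense range (`denseRange_toEnvLimit`): the closed ideals of finite
codimension are downward directed, and `𝐔` of a surjection has dense range because `𝐔(𝔥)` has no
proper closed subalgebra containing the image of `𝔥` (`IsEnveloping.eq_top_of_isClosed`). Since the
limit is Hausdorff, the left inverse is then a two-sided inverse.
-/

section EnvelopingLimit

variable {𝕜 : Type} [RCLike 𝕜]

/-- The image of `𝔤` generates an enveloping algebra topologically: a closed subalgebra `S` containing
it is itself weakly complete, so the universal property yields a section of the inclusion `S → U`. -/
theorem IsEnveloping.eq_top_of_isClosed {𝔤 : Type u} [LieRing 𝔤] [LieAlgebra 𝕜 𝔤]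
    [TopologicalSpace 𝔤] {U : WCAlg.{u} 𝕜} {lam : 𝔤 →ₗ⁅𝕜⁆ U} (h : IsEnveloping U lam)
    (S : Subalgebra 𝕜 U) (hS : IsClosed (S : Set U)) (hlam : ∀ x, lam x ∈ S) : S = ⊤ := by
  obtain ⟨J, ⟨e⟩⟩ := U.weaklyComplete
  -- `S` is packaged as an abstract weakly complete algebra `B` with an embedding `v` onto `S`
  have hSr : IsTopologicalRing S := S.isTopologicalRing_coe
  obtain ⟨B, v, hv, hvS⟩ : ∃ (B : WCAlg.{u} 𝕜) (v : B →ₐ[𝕜] U), IsEmbedding v ∧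
      ∀ z, z ∈ S ↔ ∃ b, v b = z :=
    ⟨⟨S, isWeaklyComplete_of_isClosedEmbedding
        (e.toLinearEquiv.toLinearMap.comp S.val.toLinearMap)
        (e.toHomeomorph.isClosedEmbedding.comp hS.isClosedEmbedding_subtypeVal)⟩, S.val,
      .subtypeVal, fun z => ⟨fun h => ⟨⟨z, h⟩, rfl⟩, fun ⟨b, hb⟩ => hb ▸ b.2⟩⟩
  choose l hl using fun x => (hvS _).1 (hlam x)
  let f : 𝔤 →ₗ⁅𝕜⁆ B :=
    { toFun := l
      map_add' := fun x y => hv.injective (by rw [hl, map_add, map_add, hl, hl])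
      map_smul' := fun c x => hv.injective (by rw [hl, map_smul, map_smul, hl]; rfl)
      map_lie' := fun {x y} => hv.injective (by
        rw [hl, WCAlg.lie_def, map_sub, map_mul, map_mul, hl, hl, LieHom.map_lie, WCAlg.lie_def]) }
  have hf : Continuous f := hv.continuous_iff.2 (by convert h.1 using 1; exact funext hl)
  obtain ⟨r, hr, -⟩ := h.2 B f hf
  let v' : B →A[𝕜] U := { v with cont := hv.continuous }
  have hid : v'.comp r = ContinuousAlgHom.id 𝕜 U := by
    refine (h.2 U lam h.1).unique (fun x => ?_) fun x => rfl
    change v (r (lam x)) = _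
    rw [hr]
    exact hl x
  refine eq_top_iff.2 fun u _ => (hvS u).2 ⟨r u, DFunLike.congr_fun hid u⟩

theorem WCEnv.denseRange_map {𝔤 𝔥 : Type u} [LieRing 𝔤] [LieAlgebra 𝕜 𝔤] [TopologicalSpace 𝔤]
    [LieRing 𝔥] [LieAlgebra 𝕜 𝔥] [TopologicalSpace 𝔥] (f : 𝔤 →ₗ⁅𝕜⁆ 𝔥) (hf : Continuous f)
    (hs : Function.Surjective f) : DenseRange (WCEnv.map 𝕜 f hf) := by
  let R : Subalgebra 𝕜 (WCEnv 𝕜 𝔥) := (WCEnv.map 𝕜 f hf : WCEnv 𝕜 𝔤 →ₐ[𝕜] WCEnv 𝕜 𝔥).range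
  have htop : R.topologicalClosure = ⊤ :=
    (WCEnv.isEnveloping 𝕜 𝔥).eq_top_of_isClosed _ R.isClosed_topologicalClosure fun y => by
      obtain ⟨x, rfl⟩ := hs y
      exact R.le_topologicalClosure ⟨WCEnv.lam 𝕜 𝔤 x, WCEnv.map_lam 𝕜 f hf x⟩
  intro u
  have hu : u ∈ R.topologicalClosure := htop ▸ Algebra.mem_top
  exact hu

/-- A finite matrix algebra as a weakly complete algebra. The index type lives in `Type u`, which
places the matrix algebra in the same universe as the Lie algebras under consideration. -/
def WCAlg.matrix (𝕜 : Type) [RCLike 𝕜] (ι : Type u) [Fintype ι] [DecidableEq ι] :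
    WCAlg.{u} 𝕜 where
  carrier := Matrix ι ι 𝕜
  topRing := Matrix.topologicalRing (R := 𝕜)
  weaklyComplete := ⟨Σ _ : ι, ι,
    exists_pi_equiv (E := fun _ : ι => ι → 𝕜) fun _ => ContinuousLinearEquiv.refl 𝕜 _⟩

variable {𝔤 : Type u} [LieRing 𝔤] [LieAlgebra 𝕜 𝔤] [TopologicalSpace 𝔤]

/-- A morphism from `𝐔(𝔤)` to a finite-dimensional algebra factors through `𝐔(𝔤 ⧸ I)` for `I` the
kernel of its restriction to `𝔤`, which is closed and of finite codimension. -/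
theorem WCEnv.exists_factor (A : WCAlg.{u} 𝕜) [FiniteDimensional 𝕜 A] (F : WCEnv 𝕜 𝔤 →A[𝕜] A) :
    ∃ (I : CofinIdeal 𝕜 𝔤) (G : WCEnv 𝕜 (𝔤 ⧸ I.1) →A[𝕜] A),
      ∀ u, F u = G (WCEnv.map 𝕜 I.1.quot I.1.continuous_quot u) := by
  let f : 𝔤 →ₗ⁅𝕜⁆ A :=
    { toFun := fun x => F (WCEnv.lam 𝕜 𝔤 x)
      map_add' := fun x y => by rw [map_add, map_add]
      map_smul' := fun c x => by rw [map_smul, map_smul]; rfl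
      map_lie' := fun {x y} => by
        rw [LieHom.map_lie, WCAlg.lie_def, WCAlg.lie_def, map_sub, map_mul, map_mul] }
  have hf : Continuous f := F.continuous.comp (WCEnv.isEnveloping 𝕜 𝔤).1
  have hker : IsClosed (f.ker : Set 𝔤) := by
    have : (f.ker : Set 𝔤) = f ⁻¹' {0} := by ext x; exact LieHom.mem_ker
    rw [this]
    exact isClosed_singleton.preimage hf
  have hfin : FiniteDimensional 𝕜 (𝔤 ⧸ f.ker) :=
    Module.Finite.equiv (f : 𝔤 →ₗ[𝕜] A).quotKerEquivRange.symm
  let g : 𝔤 ⧸ f.ker →ₗ⁅𝕜⁆ A :=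
    { (f.ker : Submodule 𝕜 𝔤).liftQ (f : 𝔤 →ₗ[𝕜] A) (fun x hx => LieHom.mem_ker.1 hx) with
      map_lie' := fun {x y} => by
        induction x using Submodule.Quotient.induction_on
        induction y using Submodule.Quotient.induction_on
        exact f.map_lie _ _ }
  have hg : Continuous g := Continuous.quotient_lift hf _
  obtain ⟨G, hG, -⟩ := (WCEnv.isEnveloping 𝕜 (𝔤 ⧸ f.ker)).2 A g hg
  refine ⟨⟨f.ker, hker, hfin⟩, G, fun u => DFunLike.congr_fun (f := F)
    (g := G.comp (WCEnv.map 𝕜 f.ker.quot f.ker.continuous_quot)) ?_ u⟩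
  refine ((WCEnv.isEnveloping 𝕜 𝔤).2 A f hf).unique (fun x => rfl) fun x => ?_
  rw [ContinuousAlgHom.comp_apply, WCEnv.map_lam, hG]
  rfl

/-- Every continuous functional on `𝐔(𝔤)` factors through some `𝐔(𝔤 ⧸ I)`, being a coefficient of
a finite-dimensional representation. -/
theorem WCEnv.exists_factor_functional (φ : WCEnv 𝕜 𝔤 →L[𝕜] 𝕜) :
    ∃ (I : CofinIdeal 𝕜 𝔤) (χ : WCEnv 𝕜 (𝔤 ⧸ I.1) → 𝕜), Continuous χ ∧
      ∀ u, φ u = χ (WCEnv.map 𝕜 I.1.quot I.1.continuous_quot u) := by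
  obtain ⟨n, ρ, ψ, hρ, hψ⟩ := WCAlg.exists_rep _ φ
  let r : Matrix (Fin n) (Fin n) 𝕜 ≃ₐ[𝕜] Matrix (ULift.{u} (Fin n)) (ULift.{u} (Fin n)) 𝕜 :=
    Matrix.reindexAlgEquiv 𝕜 𝕜 Equiv.ulift.symm
  have hr : Continuous r := r.toLinearMap.continuous_of_finiteDimensional
  have hr' : Continuous r.symm := r.symm.toLinearMap.continuous_of_finiteDimensional
  have hψc : Continuous ψ := ψ.continuous_of_finiteDimensional
  have hfd : FiniteDimensional 𝕜 (WCAlg.matrix 𝕜 (ULift.{u} (Fin n))) :=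
    inferInstanceAs (FiniteDimensional 𝕜 (Matrix (ULift.{u} (Fin n)) (ULift.{u} (Fin n)) 𝕜))
  let F : WCEnv 𝕜 𝔤 →A[𝕜] WCAlg.matrix 𝕜 (ULift.{u} (Fin n)) :=
    { r.toAlgHom.comp ρ with
      cont := hr.comp hρ }
  obtain ⟨I, G, hG⟩ := WCEnv.exists_factor _ F
  refine ⟨I, fun w => ψ (r.symm (G w)), hψc.comp (hr'.comp G.continuous), fun u => ?_⟩
  have hFu : r.symm (F u) = ρ u := r.symm_apply_apply _
  rw [hψ, ← hFu, hG]

variable (𝕜 𝔤) in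
theorem envLimit.isEmbedding_proj :
    IsEmbedding fun (x : envLimit 𝕜 𝔤) (I : CofinIdeal 𝕜 𝔤) => envLimit.proj 𝕜 𝔤 I x :=
  (IsEmbedding.subtypeVal :
    IsEmbedding (Subtype.val : envLimitSubalgebra 𝕜 𝔤 → _))

theorem envLimit.map_proj (x : envLimit 𝕜 𝔤) {J I : CofinIdeal 𝕜 𝔤} (h : J.1 ≤ I.1) :
    WCEnv.map 𝕜 (LieIdeal.quotMap h) (LieIdeal.continuous_quotMap h) (envLimit.proj 𝕜 𝔤 J x) =
      envLimit.proj 𝕜 𝔤 I x :=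
  x.2 J I h

theorem CofinIdeal.exists_le_of_finset (S : Finset (CofinIdeal 𝕜 𝔤)) :
    ∃ J : CofinIdeal 𝕜 𝔤, ∀ I ∈ S, J.1 ≤ I.1 := by
  classical
  induction S using Finset.induction_on with
  | empty =>
    have : FiniteDimensional 𝕜 (𝔤 ⧸ (⊤ : LieIdeal 𝕜 𝔤)) :=
      inferInstanceAs (FiniteDimensional 𝕜 (𝔤 ⧸ (⊤ : Submodule 𝕜 𝔤)))
    exact ⟨⟨⊤, isClosed_univ, this⟩, by simp⟩
  | insert K S _ ih =>
    obtain ⟨J, hJ⟩ := ih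
    have hfin : FiniteDimensional 𝕜 (𝔤 ⧸ (K.1 ⊓ J.1 : LieIdeal 𝕜 𝔤)) :=
      Submodule.CoFG.inf (S := (K.1 : Submodule 𝕜 𝔤)) (T := (J.1 : Submodule 𝕜 𝔤)) K.2.2 J.2.2
    refine ⟨⟨K.1 ⊓ J.1, K.2.1.inter J.2.1, hfin⟩, fun I hI => ?_⟩
    rcases Finset.mem_insert.1 hI with rfl | hI
    · exact inf_le_left
    · exact inf_le_right.trans (hJ I hI)

variable (𝕜 𝔤) in
/-- A basic open set of the limit involves finitely many ideals, hence is pulled back from a single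
`𝐔(𝔤 ⧸ J)`, in which the image of `𝐔(𝔤)` is dense. -/
theorem denseRange_toEnvLimit : DenseRange (toEnvLimit 𝕜 𝔤) := by
  intro x
  rw [mem_closure_iff]
  intro O hO hx
  obtain ⟨V, hV, rfl⟩ := (envLimit.isEmbedding_proj 𝕜 𝔤).isInducing.isOpen_iff.1 hO
  obtain ⟨S, v, hv, hSV⟩ := isOpen_pi_iff.1 hV _ hx
  obtain ⟨J, hJ⟩ := CofinIdeal.exists_le_of_finset S
  let W : Set (WCEnv 𝕜 (𝔤 ⧸ J.1)) := ⋂ I : S,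
    WCEnv.map 𝕜 (LieIdeal.quotMap (hJ I.1 I.2)) (LieIdeal.continuous_quotMap _) ⁻¹' v I.1
  have hW : IsOpen W := isOpen_iInter_of_finite fun I =>
    (hv I.1 I.2).1.preimage (WCEnv.map 𝕜 _ _).continuous
  have hxW : envLimit.proj 𝕜 𝔤 J x ∈ W := Set.mem_iInter.2 fun I => by
    rw [Set.mem_preimage, envLimit.map_proj]
    exact (hv I.1 I.2).2
  obtain ⟨u, hu⟩ := (WCEnv.denseRange_map J.1.quot J.1.continuous_quot
    Quotient.mk_surjective).exists_mem_open hW ⟨_, hxW⟩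
  refine ⟨toEnvLimit 𝕜 𝔤 u, hSV fun I hI => ?_, u, rfl⟩
  have h := Set.mem_iInter.1 hu ⟨I, hI⟩
  rw [Set.mem_preimage, ← envLimit.proj_toEnvLimit, envLimit.map_proj] at h
  exact h

variable (𝕜 𝔤) in
/-- Assembled from the factorizations of the coordinates of `𝐔(𝔤) ≃ 𝕜 ^ J`. -/
theorem exists_leftInverse_toEnvLimit :
    ∃ Ψ : envLimit 𝕜 𝔤 → WCEnv 𝕜 𝔤, Continuous Ψ ∧ Function.LeftInverse Ψ (toEnvLimit 𝕜 𝔤) := by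
  obtain ⟨J, ⟨e⟩⟩ := (WCEnv 𝕜 𝔤).weaklyComplete
  choose I χ hχ hfac using fun j : J => WCEnv.exists_factor_functional
    ((ContinuousLinearMap.proj j).comp e.toContinuousLinearMap)
  refine ⟨fun x => e.symm fun j => χ j (envLimit.proj 𝕜 𝔤 (I j) x),
    e.symm.continuous.comp
      (continuous_pi fun j => (hχ j).comp (envLimit.proj 𝕜 𝔤 (I j)).continuous),
    fun u => ?_⟩
  rw [ContinuousLinearEquiv.symm_apply_eq]
  ext j
  rw [envLimit.proj_toEnvLimit, ← hfac]
  rfl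

end EnvelopingLimit

theorem theorem1p10 (𝕜 : Type) [RCLike 𝕜] (𝔤 : Type u) [LieRing 𝔤] [LieAlgebra 𝕜 𝔤]
    [TopologicalSpace 𝔤] (h𝔤 : IsProfiniteDimensional 𝕜 𝔤) :
    (∃ e : 𝔤 ≃ₗ⁅𝕜⁆ lieLimit 𝕜 𝔤, Continuous e ∧ Continuous e.symm ∧
      ∀ x, e x = toLieLimit 𝕜 𝔤 x) ∧
    ∃ e : WCEnv 𝕜 𝔤 ≃A[𝕜] envLimit 𝕜 𝔤, ∀ u, e u = toEnvLimit 𝕜 𝔤 u := by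
  constructor
  · have h := h𝔤.isHomeomorph_toLieLimit
    exact ⟨LieEquiv.ofBijective (toLieLimit 𝕜 𝔤) h.bijective, h.continuous,
      (h.homeomorph _).continuous_symm.congr fun y => by
        rw [Homeomorph.symm_apply_eq]
        exact ((LieEquiv.ofBijective (toLieLimit 𝕜 𝔤) h.bijective).apply_symm_apply y).symm,
      fun x => rfl⟩
  · obtain ⟨Ψ, hΨ, hleft⟩ := exists_leftInverse_toEnvLimit 𝕜 𝔤
    have hright : Function.RightInverse Ψ (toEnvLimit 𝕜 𝔤) := fun x =>
      isClosed_property (p := fun x => toEnvLimit 𝕜 𝔤 (Ψ x) = x) (denseRange_toEnvLimit 𝕜 𝔤)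
        (isClosed_eq ((toEnvLimit 𝕜 𝔤).continuous.comp hΨ) continuous_id)
        (fun u => by rw [hleft u]) x
    exact ⟨{ (toEnvLimit 𝕜 𝔤 : WCEnv 𝕜 𝔤 →ₐ[𝕜] envLimit 𝕜 𝔤) with
        invFun := Ψ
        left_inv := hleft
        right_inv := hright
        continuous_toFun := (toEnvLimit 𝕜 𝔤).continuous
        continuous_invFun := hΨ }, fun u => rfl⟩
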